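/- Let $P\subseteq\mathbb R^D$ be a full-dimensional polyhedron that is the intersection of $n$ closed halfspaces and has at least one vertex (that is, $P$ is pointed). A face of $P$ is a set of the form $P\cap H$, where $H$ is a closed halfspace whose boundary hyperplane is disjoint from the relative interior of $P$ (so $\emptyset$ and $P$ itself count as faces); its dimension is the dimension of its affine hull, with $\dim\emptyset=-1$; a vertex is a $0$-dimensional face. Let $\ell:\mathbb R^D\to\mathbb R$ be a linear (possibly inhomogeneous, i.e. affine) function that attains a minimum on $P$, let $B$ be a real number greater than this minimum, and let $P^{\ell<B}$ be the set of all faces $f$ of $P$ such that $\ell(p)<B$ for every point $p\in f$. Suppose that the maximum dimension $d$ of a face in $P^{\ell<B}$ satisfies $d<D$. Then the number of vertices of $P^{\ell<B}$ is finite and at most $$\binom{n}{d}-\binom{D}{d}+1 .$$ -/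

import Mathlib

open scoped RealInnerProductSpace

noncomputable section

/-- `H` is a closed halfspace of `ℝ^D`. -/
def IsClosedHalfspace {D : ℕ} (H : Set (EuclideanSpace ℝ (Fin D))) : Prop :=
  ∃ (a : EuclideanSpace ℝ (Fin D)) (b : ℝ), a ≠ 0 ∧ H = {x | ⟪a, x⟫ ≤ b}

/-- `f` is a face of `P`: the intersection of `P` with a closed halfspace `{x | ⟪a, x⟫ ≤ b}` whose
boundary hyperplane `{x | ⟪a, x⟫ = b}` is disjoint from the relative interior of `P`.
The empty set and `P` itself are thus allowed as faces. -/
def IsFace {D : ℕ} (P f : Set (EuclideanSpace ℝ (Fin D))) : Prop :=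
  ∃ (a : EuclideanSpace ℝ (Fin D)) (b : ℝ), a ≠ 0 ∧
    Disjoint {x | ⟪a, x⟫ = b} (intrinsicInterior ℝ P) ∧ f = P ∩ {x | ⟪a, x⟫ ≤ b}

open Classical in
/-- The dimension of a set: the dimension of its affine hull, with the convention that the
empty set has dimension `-1`. -/
def setDim {D : ℕ} (S : Set (EuclideanSpace ℝ (Fin D))) : ℤ :=
  if S = ∅ then -1 else (Module.finrank ℝ (affineSpan ℝ S).direction : ℤ)

/-- The set of vertices of `P`, that is, of its `0`-dimensional faces
(each of them a one-point set). -/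
def vertexFaces {D : ℕ} (P : Set (EuclideanSpace ℝ (Fin D))) :
    Set (Set (EuclideanSpace ℝ (Fin D))) :=
  {f | IsFace P f ∧ setDim f = 0}

/-- The complex `P^{ℓ<B}`: the set of faces of `P` at all of whose points `ℓ` is less than `B`. -/
def subLevelComplex {D : ℕ} (P : Set (EuclideanSpace ℝ (Fin D)))
    (l : EuclideanSpace ℝ (Fin D) →ᵃ[ℝ] ℝ) (B : ℝ) :
    Set (Set (EuclideanSpace ℝ (Fin D))) :=
  {f | IsFace P f ∧ ∀ p ∈ f, l p < B}

/-- The set `C` of faces has dimension `d`: `d` is the maximum dimension of a face in `C`. -/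
def HasComplexDim {D : ℕ} (C : Set (Set (EuclideanSpace ℝ (Fin D)))) (d : ℤ) : Prop :=
  IsGreatest (setDim '' C) d

end

/-! To each vertex `v` below level `B` one attaches a set `J v` of exactly `d` defining
inequalities, tight at `v`, such that `v` minimizes a generic perturbation `L` of `ℓ` on the face
cut out by `J v`. Then `J` is injective. If `v₀` is the `L`-least of these vertices, no other `J v`
consists of inequalities tight at `v₀`; at least `D` are tight there, so `C(D,d)` of the `d`-subsets
are missed (`card_add_choose_le`).

The sets `J v` come from `exists_neg_face_and_nonneg_face`: the tangent cone at `v` has a face `F`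
where `L < 0` off the apex and a face `G`, cut out by at most `dim F` inequalities, where `L ≥ 0`.
Since `F` belongs to a face of `P` on which `ℓ ≤ ℓ(v) < B`, its dimension is at most `d`, and the
inequalities for `G` can be padded to `d` tight ones. -/

/-! ### Pointed cones and their extreme rays. -/

section Cone

variable {ι V M : Type*} [AddCommGroup V] [Module ℝ V]

/-- The face of the cone `{x | ∀ i ∈ A, 0 ≤ φ i x}` on which the `φ i` with `i ∈ I` vanish. -/
def coneFace (φ : ι → V →ₗ[ℝ] ℝ) (A I : Finset ι) : Set V :=
  {x | (∀ i ∈ A, 0 ≤ φ i x) ∧ ∀ i ∈ I, φ i x = 0}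

/-- A normalized generator of an extreme ray of the cone `{x | ∀ i ∈ A, 0 ≤ φ i x}`. -/
def IsConeRay (φ : ι → V →ₗ[ℝ] ℝ) (A : Finset ι) (x : V) : Prop :=
  (∀ i ∈ A, 0 ≤ φ i x) ∧ ∑ i ∈ A, φ i x = 1 ∧
    ∀ y, (∀ i ∈ A, φ i x = 0 → φ i y = 0) → ∃ c : ℝ, y = c • x

/-- Moving in a direction that leaves the cone, one hits a new facet. -/
lemma exists_hit_facet (φ : ι → V →ₗ[ℝ] ℝ) (A : Finset ι) {x y : V}
    (hx : ∀ i ∈ A, 0 ≤ φ i x) (hxy : ∀ i ∈ A, φ i x = 0 → φ i y = 0)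
    (hy : ∃ i ∈ A, φ i y < 0) :
    ∃ s : ℝ, 0 < s ∧ (∀ i ∈ A, 0 ≤ φ i (x + s • y)) ∧
      ∃ i ∈ A, φ i x ≠ 0 ∧ φ i (x + s • y) = 0 := by
  classical
  obtain ⟨i₁, hi₁, hi₁y⟩ := hy
  obtain ⟨j, hj, hmin⟩ := Finset.exists_min_image (A.filter fun i => φ i y < 0)
    (fun i => φ i x / (-φ i y)) ⟨i₁, by simp [hi₁, hi₁y]⟩
  simp only [Finset.mem_filter] at hj hmin
  have hjx : φ j x ≠ 0 := fun h => by
    have := hxy j hj.1 h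
    linarith [hj.2]
  have hjpos : 0 < φ j x := lt_of_le_of_ne (hx j hj.1) (Ne.symm hjx)
  refine ⟨φ j x / (-φ j y), div_pos hjpos (by linarith [hj.2]), fun i hi => ?_, j, hj.1, hjx, ?_⟩
  · simp only [map_add, map_smul, smul_eq_mul]
    by_cases h : φ i y < 0
    · have h1 := hmin i ⟨hi, h⟩
      rw [le_div_iff₀ (by linarith)] at h1
      linarith
    · have h2 : 0 < φ j x / (-φ j y) := div_pos hjpos (by linarith [hj.2])
      have := hx i hi
      have := mul_nonneg h2.le (not_lt.1 h)
      linarith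
  · have : φ j y ≠ 0 := hj.2.ne
    simp only [map_add, map_smul, smul_eq_mul]
    field_simp
    ring

lemma sum_pos_of_pointed (φ : ι → V →ₗ[ℝ] ℝ) (A : Finset ι)
    (hφ : ∀ x, (∀ i ∈ A, φ i x = 0) → x = 0) {x : V}
    (hx : ∀ i ∈ A, 0 ≤ φ i x) (hx0 : x ≠ 0) : 0 < ∑ i ∈ A, φ i x := by
  refine lt_of_le_of_ne (Finset.sum_nonneg hx) fun h => hx0 (hφ x ?_)
  exact (Finset.sum_eq_zero_iff_of_nonneg hx).1 h.symm

variable [AddCommGroup M] [LinearOrder M] [IsOrderedAddMonoid M] [Module ℝ M]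
  [PosSMulStrictMono ℝ M]

/-- A linear map that is negative on the extreme rays of a face is negative on that face. -/
lemma neg_on_coneFace_of_neg_on_rays (φ : ι → V →ₗ[ℝ] ℝ) (A I : Finset ι) (hI : I ⊆ A)
    (hφ : ∀ x, (∀ i ∈ A, φ i x = 0) → x = 0) (l : V →ₗ[ℝ] M)
    (hl : ∀ r, IsConeRay φ A r → (∀ i ∈ I, φ i r = 0) → l r < 0)
    {x : V} (hx : x ∈ coneFace φ A I) (hx0 : x ≠ 0) : l x < 0 := by
  classical
  induction hN : (A.filter fun i => φ i x ≠ 0).card using Nat.strong_induction_on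
    generalizing x with
  | _ N ih =>
  have hpos := sum_pos_of_pointed φ A hφ hx.1 hx0
  set t : ℝ := ∑ i ∈ A, φ i x with ht
  by_cases hray : ∀ y, (∀ i ∈ A, φ i x = 0 → φ i y = 0) → ∃ c : ℝ, y = c • x
  · have hr := hl (t⁻¹ • x) ⟨fun i hi => ?_, ?_, fun y hy => ?_⟩ fun i hi => by simp [hx.2 i hi]
    · have := smul_lt_smul_of_pos_left hr hpos
      simpa [smul_smul, hpos.ne'] using this
    · simpa using mul_nonneg (inv_nonneg.2 hpos.le) (hx.1 i hi)
    · simp [← Finset.mul_sum, ← ht, hpos.ne']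
    · obtain ⟨c, hc⟩ := hray y fun i hi h => hy i hi (by simp [h])
      exact ⟨c * t, by rw [smul_smul, mul_assoc, mul_inv_cancel₀ hpos.ne', mul_one, hc]⟩
  · push Not at hray
    obtain ⟨y₀, hy₀, hy₀x⟩ := hray
    -- This correction by a multiple of `x` makes the `φ i y` sum to zero, so both `y` and `-y` lead
    -- out of the cone.
    set y := y₀ - ((∑ i ∈ A, φ i y₀) / t) • x with hydef
    have hy : ∀ i ∈ A, φ i x = 0 → φ i y = 0 := fun i hi h => by simp [hydef, hy₀ i hi h, h]
    have hysum : ∑ i ∈ A, φ i y = 0 := by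
      simp only [hydef, map_sub, map_smul, smul_eq_mul, Finset.sum_sub_distrib, ← Finset.mul_sum,
        ← ht]
      field_simp
      ring
    have hyne : ∃ i ∈ A, φ i y ≠ 0 := by
      by_contra! h
      exact hy₀x _ (sub_eq_zero.1 (hφ y h))
    have key : ∀ z : V, (∀ i ∈ A, φ i x = 0 → φ i z = 0) → ∑ i ∈ A, φ i z = 0 →
        (∃ i ∈ A, φ i z ≠ 0) → ∃ s : ℝ, 0 < s ∧ l (x + s • z) < 0 := by
      intro z hz hzsum hzne
      have hneg : ∃ i ∈ A, φ i z < 0 := by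
        by_contra! h
        obtain ⟨i, hi, hne⟩ := hzne
        exact hne ((Finset.sum_eq_zero_iff_of_nonneg h).1 hzsum i hi)
      obtain ⟨s, hs, hcone, i, hi, hix, hi0⟩ := exists_hit_facet φ A hx.1 hz hneg
      refine ⟨s, hs, ih _ ?_ (x := x + s • z)
        ⟨hcone, fun i hi => by simp [hx.2 i hi, hz i (hI hi) (hx.2 i hi)]⟩ ?_ rfl⟩
      · rw [← hN]
        apply Finset.card_lt_card
        rw [Finset.ssubset_iff_of_subset]
        · exact ⟨i, by simp [hi, hix], by simpa using fun _ => hi0⟩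
        · intro j
          simp only [Finset.mem_filter]
          rintro ⟨hj, hjx⟩
          refine ⟨hj, fun h => hjx ?_⟩
          simp [h, hz j hj h]
      · intro h0
        have h1 : ∑ i ∈ A, φ i (x + s • z) = t := by
          simp [Finset.sum_add_distrib, ← Finset.mul_sum, hzsum, ← ht]
        rw [h0] at h1
        simp only [map_zero, Finset.sum_const_zero] at h1
        linarith
    -- `x` lies between two points at which more functionals vanish; `l` is negative at both.
    obtain ⟨s, hs, h1⟩ := key y hy hysum hyne
    obtain ⟨s', hs', h2⟩ := key (-y) (fun i hi h => by simp [hy i hi h]) (by simp [hysum])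
      (by simpa using hyne)
    by_contra! hlx
    have e1 := smul_lt_smul_of_pos_left h1 hs'
    have e2 := smul_lt_smul_of_pos_left h2 hs
    have e3 : s' • l (x + s • y) + s • l (x + s' • -y) = (s' + s) • l x := by
      simp only [map_add, map_smul, map_neg]
      module
    have e4 : 0 ≤ (s' + s) • l x := by
      have := smul_le_smul_of_nonneg_left hlx (by linarith : (0:ℝ) ≤ s' + s)
      simpa using this
    rw [smul_zero] at e1 e2
    rw [← e3] at e4
    exact absurd e4 (not_le.2 (add_neg e1 e2))

end Cone

/-! ### Complementary negative and nonnegative faces of a cone. -/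

section ConeDecomposition

variable {ι : Type*}

/-- Vandermonde. This yields infinitely many vectors, any `k` of them independent, to which the
pigeonhole principle can be applied. -/
lemma linearIndependent_momentCurve {V : Type*} [AddCommGroup V] [Module ℝ V] {k : ℕ}
    {w : Fin k → V} (hw : LinearIndependent ℝ w) {τ : Fin k → ℝ} (hτ : Function.Injective τ) :
    LinearIndependent ℝ fun t => ∑ j : Fin k, τ t ^ (j : ℕ) • w j := by
  rw [Fintype.linearIndependent_iff] at hw ⊢
  intro c hc
  have h0 : ∑ j : Fin k, (∑ t, c t * τ t ^ (j : ℕ)) • w j = 0 := by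
    rw [← hc]
    simp only [Finset.sum_smul, Finset.smul_sum, smul_smul]
    exact Finset.sum_comm
  exact congrFun (Matrix.eq_zero_of_forall_pow_sum_mul_pow_eq_zero hτ (hw _ h0))

/-- The functionals vanishing on a ray determine it up to a scalar, and the normalization fixes the
scalar. -/
lemma finite_setOf_isConeRay {V : Type*} [AddCommGroup V] [Module ℝ V]
    (φ : ι → V →ₗ[ℝ] ℝ) (A : Finset ι) : {x | IsConeRay φ A x}.Finite := by
  classical
  refine Set.Finite.of_injOn (f := fun x => A.filter fun i => φ i x = 0)
    (t := (A.powerset : Set (Finset ι)))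
    (fun x _ => Finset.mem_coe.2 (Finset.mem_powerset.2 (Finset.filter_subset _ _))) ?_
    (Finset.finite_toSet _)
  intro x hx y hy hxy
  have hxy' : ∀ i ∈ A, φ i x = 0 → φ i y = 0 := fun i hi h => by
    have : i ∈ A.filter fun i => φ i y = 0 := by
      rw [← show (A.filter fun i => φ i x = 0) = A.filter fun i => φ i y = 0 from hxy]
      simp [hi, h]
    simpa using (Finset.mem_filter.1 this).2
  obtain ⟨c, rfl⟩ := hx.2.2 y hxy'
  have h1 := hy.2.1
  simp only [map_smul, smul_eq_mul, ← Finset.mul_sum, hx.2.1, mul_one] at h1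
  simp [h1]

/-- Translating along a ray `u` until the boundary of the cone is reached. -/
lemma exists_translate_mem_facet {V : Type*} [AddCommGroup V] [Module ℝ V]
    (φ : ι → V →ₗ[ℝ] ℝ) (A : Finset ι) {u : V} (hu : IsConeRay φ A u) (z : V)
    (hz : ∀ i ∈ A, φ i u = 0 → 0 ≤ φ i z) :
    ∃ i ∈ A, φ i u ≠ 0 ∧ ∃ s : ℝ, (∀ j ∈ A, 0 ≤ φ j (z + s • u)) ∧ φ i (z + s • u) = 0 := by
  classical
  have hne : (A.filter fun i => φ i u ≠ 0).Nonempty := by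
    by_contra! h
    have h1 := hu.2.1
    rw [Finset.sum_eq_zero fun i hi => by
      by_contra hi0
      exact Finset.notMem_empty i (h ▸ Finset.mem_filter.2 ⟨hi, hi0⟩)] at h1
    exact zero_ne_one h1
  obtain ⟨i, hi, hmax⟩ := Finset.exists_max_image _ (fun i => -φ i z / φ i u) hne
  simp only [Finset.mem_filter] at hi hmax
  refine ⟨i, hi.1, hi.2, -φ i z / φ i u, fun j hj => ?_, ?_⟩
  · simp only [map_add, map_smul, smul_eq_mul]
    by_cases hj0 : φ j u = 0
    · simpa [hj0] using hz j hj hj0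
    · have := hmax j ⟨hj, hj0⟩
      rw [div_le_iff₀ (lt_of_le_of_ne (hu.1 j hj) (Ne.symm hj0))] at this
      linarith
  · simp only [map_add, map_smul, smul_eq_mul]
    rw [div_mul_cancel₀ _ hi.2, add_neg_cancel]

/-- Finitely many functionals with trivial common kernel on a subspace contain at most as many
as the dimension of the subspace with the same property. -/
lemma exists_subset_card_le_finrank {V : Type*} [AddCommGroup V] [Module ℝ V]
    (φ : ι → V →ₗ[ℝ] ℝ) (A : Finset ι) (W : Submodule ℝ V) [FiniteDimensional ℝ W]
    (hφ : ∀ x ∈ W, (∀ i ∈ A, φ i x = 0) → x = 0) :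
    ∃ J ⊆ A, J.card ≤ Module.finrank ℝ W ∧ ∀ x ∈ W, (∀ i ∈ J, φ i x = 0) → x = 0 := by
  classical
  let S : Set (W →ₗ[ℝ] ℝ) := (fun i => φ i ∘ₗ W.subtype) '' (A : Set ι)
  obtain ⟨f, hfS, hspan, -⟩ := Submodule.exists_fun_fin_finrank_span_eq ℝ S
  choose g hgA hg using hfS
  refine ⟨Finset.univ.image g, ?_, ?_, fun x hx h => ?_⟩
  · intro i hi
    obtain ⟨t, -, rfl⟩ := Finset.mem_image.1 hi
    exact hgA t
  · refine Finset.card_image_le.trans ?_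
    rw [Finset.card_univ, Fintype.card_fin, ← Subspace.dual_finrank_eq (K := ℝ) (V := W)]
    exact Submodule.finrank_le _
  · refine hφ x hx fun i hi => ?_
    have hker : Submodule.span ℝ S ≤ 
        LinearMap.ker (LinearMap.applyₗ (R := ℝ) (M₂ := ℝ) (⟨x, hx⟩ : W)) := by
      rw [← hspan, Submodule.span_le]
      rintro _ ⟨t, rfl⟩
      have := h (g t) (Finset.mem_image_of_mem _ (Finset.mem_univ t))
      simpa [← hg t] using this
    have := hker (Submodule.subset_span ⟨i, hi, rfl⟩)
    simpa using this

/-- In a pointed polyhedral cone with a linear map `l` to an ordered vector space, there are a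
face on which `l` is negative (except at the origin) and a face on which `l` is nonnegative whose
dimensions add up to at least the dimension of the cone. -/
theorem exists_neg_face_and_nonneg_face {M : Type*} [AddCommGroup M] [LinearOrder M]
    [IsOrderedAddMonoid M] [Module ℝ M] [PosSMulStrictMono ℝ M]
    {V : Type*} [AddCommGroup V] [Module ℝ V] [FiniteDimensional ℝ V]
    (φ : ι → V →ₗ[ℝ] ℝ) (A : Finset ι)
    (hφ : ∀ x, (∀ i ∈ A, φ i x = 0) → x = 0) (l : V →ₗ[ℝ] M) :
    ∃ I ⊆ A, ∃ J ⊆ A, ∃ k, J.card ≤ k ∧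
      (∃ w : Fin k → V, LinearIndependent ℝ w ∧ ∀ t, w t ∈ coneFace φ A I) ∧
      (∀ x ∈ coneFace φ A I, x ≠ 0 → l x < 0) ∧ ∀ x ∈ coneFace φ A J, 0 ≤ l x := by
  classical
  induction hN : Module.finrank ℝ V using Nat.strong_induction_on generalizing V A with
  | _ N ih =>
  by_cases hneg : ∀ r, IsConeRay φ A r → l r < 0
  · have hC : ∀ x ∈ coneFace φ A ∅, x ≠ 0 → l x < 0 := fun x hx hx0 =>
      neg_on_coneFace_of_neg_on_rays φ A ∅ (by simp) hφ l (fun r hr _ => hneg r hr) hx hx0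
    obtain ⟨w, hwC, -, hw⟩ := Submodule.exists_fun_fin_finrank_span_eq ℝ (coneFace φ A ∅)
    obtain ⟨J, hJA, hJ, hJ0⟩ := exists_subset_card_le_finrank φ A
      (Submodule.span ℝ (coneFace φ A ∅)) fun x _ => hφ x
    refine ⟨∅, by simp, J, hJA, _, hJ, ⟨w, hw, hwC⟩, hC, fun x hx => ?_⟩
    rw [hJ0 x (Submodule.subset_span ⟨hx.1, by simp⟩) hx.2, map_zero]
  · push Not at hneg
    obtain ⟨r₀, hr₀, hr₀l⟩ := hneg
    -- With `l u` the least nonnegative value on rays, any ray of smaller value is negative.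
    obtain ⟨u, ⟨hu, hul⟩, hmin⟩ := Set.exists_min_image {r | IsConeRay φ A r ∧ 0 ≤ l r} l
      ((finite_setOf_isConeRay φ A).subset fun _ h => h.1) ⟨r₀, hr₀, hr₀l⟩
    set h : V →ₗ[ℝ] ℝ := ∑ i ∈ A, φ i with hdef
    have happ : ∀ x, h x = ∑ i ∈ A, φ i x := fun x => by simp [hdef]
    have hhu : h u = 1 := by rw [happ, hu.2.1]
    set K := LinearMap.ker h with hK
    have hlt : Module.finrank ℝ K < N := by
      rw [← hN]
      refine Submodule.finrank_lt (lt_top_iff_ne_top.2 fun htop => ?_).ne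
      have : u ∈ K := htop ▸ Submodule.mem_top
      rw [hK, LinearMap.mem_ker, hhu] at this
      exact one_ne_zero this
    -- Induction applies to the tangent cone at `u` of the slice `h = 1`: directions in `K`,
    -- constraints vanishing at `u`.
    obtain ⟨I, hI, J, hJ, k, hJk, ⟨w, hw, hwI⟩, hFneg, hGpos⟩ := ih _ hlt
      (fun i => φ i ∘ₗ K.subtype) (A.filter fun i => φ i u = 0) (by
        rintro ⟨x, hx⟩ h0
        obtain ⟨c, rfl⟩ := hu.2.2 x fun i hi hiu => h0 i (by simp [hi, hiu])
        rw [hK, LinearMap.mem_ker, map_smul, hhu, smul_eq_mul, mul_one] at hx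
        simp [hx]) (l ∘ₗ K.subtype) rfl
    have hIu : ∀ i ∈ I, i ∈ A ∧ φ i u = 0 := fun i hi => by simpa using hI hi
    have hJu : ∀ i ∈ J, i ∈ A ∧ φ i u = 0 := fun i hi => by simpa using hJ hi
    have hwnn : ∀ t, ∀ i ∈ A, φ i u = 0 → 0 ≤ φ i (w t) := fun t i hi h0 =>
      (hwI t).1 i (by simp [hi, h0])
    have hwz : ∀ t, ∀ i ∈ I, φ i (w t) = 0 := fun t i hi => (hwI t).2 i hi
    let z : ℕ → K := fun m => ∑ j : Fin k, (m : ℝ) ^ (j : ℕ) • w j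
    have hznn : ∀ m, ∀ i ∈ A, φ i u = 0 → 0 ≤ φ i (z m) := fun m i hi h0 => by
      simp only [z, Submodule.coe_sum, Submodule.coe_smul, map_sum, map_smul, smul_eq_mul]
      exact Finset.sum_nonneg fun j _ => mul_nonneg (by positivity) (hwnn j i hi h0)
    have hzz : ∀ m, ∀ i ∈ I, φ i (z m) = 0 := fun m i hi => by
      simp [z, hwz _ i hi]
    choose i₀ hi₀A hi₀u s hs hs0 using fun m => exists_translate_mem_facet φ A hu (z m) (hznn m)
    -- Infinitely many translates land on finitely many facets, so `k` of them share a facet `i₁`,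
    -- which misses `u`.
    obtain ⟨⟨i₁, hi₁A⟩, hinf⟩ := Finite.exists_infinite_fiber fun m => (⟨i₀ m, hi₀A m⟩ : A)
    let e := Infinite.natEmbedding ↑((fun m => (⟨i₀ m, hi₀A m⟩ : A)) ⁻¹' {⟨i₁, hi₁A⟩})
    have he : ∀ m, i₀ (e m) = i₁ := fun m => congrArg Subtype.val (e m).2
    have hi₁u : φ i₁ u ≠ 0 := he 0 ▸ hi₀u (e 0)
    have hsub : insert i₁ I ⊆ A := Finset.insert_subset hi₁A fun i hi => (hIu i hi).1
    refine ⟨insert i₁ I, hsub, J, fun i hi => (hJu i hi).1, k, hJk,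
      ⟨fun t => z (e t) + s (e t) • u, ?_, fun t => ⟨hs _, ?_⟩⟩, fun x hx hx0 => ?_, fun x hx => ?_⟩
    · have hz : LinearIndependent ℝ fun t : Fin k => z (e t) :=
        linearIndependent_momentCurve hw (τ := fun t : Fin k => ((e t : ℕ) : ℝ)) fun a b hab =>
          Fin.ext (e.injective (Subtype.ext (Nat.cast_injective hab)))
      rw [Fintype.linearIndependent_iff] at hz ⊢
      intro c hc
      apply hz c
      have h1 := congrArg h hc
      have hzK : ∀ m, h (z m) = 0 := fun m => (z m).2
      simp only [map_sum, map_smul, map_add, hzK, hhu, smul_eq_mul, mul_one, zero_add,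
        map_zero] at h1
      simp only [smul_add, smul_smul, Finset.sum_add_distrib, ← Finset.sum_smul, h1, zero_smul,
        add_zero] at hc
      apply Subtype.ext
      simpa using hc
    · intro i hi
      rcases Finset.mem_insert.1 hi with hi | hi
      · have := hs0 (e t)
        rw [he t] at this
        rw [hi]
        exact this
      · simp [hzz _ i hi, (hIu i hi).2]
    -- A ray `r` on facet `i₁` differs from `u`, so `l (r - u) < 0`; minimality of `l u` then forces
    -- `l r < 0`.
    · refine neg_on_coneFace_of_neg_on_rays φ A _ hsub hφ l (fun r hr hr0 => ?_) hx hx0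
      have hrK : r - u ∈ K := by
        rw [hK, LinearMap.mem_ker, map_sub, hhu, happ, hr.2.1, sub_self]
      have hlt := hFneg ⟨r - u, hrK⟩ ⟨fun i hi => ?_, fun i hi => ?_⟩ fun h0 => ?_
      · simp only [LinearMap.comp_apply, Submodule.subtype_apply, map_sub, sub_neg] at hlt
        by_contra! hlr
        exact absurd (hmin r ⟨hr, hlr⟩) (not_le.2 hlt)
      · simp only [Finset.mem_filter] at hi
        simpa [hi.2] using hr.1 i hi.1
      · simp [hr0 i (Finset.mem_insert_of_mem hi), (hIu i hi).2]
      · have : r - u = 0 := congrArg Subtype.val h0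
        rw [sub_eq_zero] at this
        exact hi₁u (this ▸ hr0 i₁ (Finset.mem_insert_self _ _))
    -- Projecting along `u` into `K` gives `l x ≥ h x • l u ≥ 0`.
    · have hxK : x - h x • u ∈ K := by
        rw [hK, LinearMap.mem_ker, map_sub, map_smul, hhu, smul_eq_mul, mul_one, sub_self]
      have hpos := hGpos ⟨x - h x • u, hxK⟩ ⟨fun i hi => ?_, fun i hi => ?_⟩
      · simp only [LinearMap.comp_apply, Submodule.subtype_apply, map_sub, map_smul,
          sub_nonneg] at hpos
        refine le_trans ?_ hpos
        have hhx : 0 ≤ h x := by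
          rw [happ]
          exact Finset.sum_nonneg hx.1
        simpa using smul_le_smul_of_nonneg_left hul hhx
      · simp only [Finset.mem_filter] at hi
        simpa [hi.2] using hx.1 i hi.1
      · simp [hx.2 i hi, (hJu i hi).2]

end ConeDecomposition

/-! ### From tangent cones to faces of the polyhedron. -/

section Polyhedron

open Filter Topology

variable {D n : ℕ}

lemma affineSpan_eq_top_of_setDim_eq {P : Set (EuclideanSpace ℝ (Fin D))}
    (hP : setDim P = D) : P.Nonempty ∧ affineSpan ℝ P = ⊤ := by
  unfold setDim at hP
  by_cases h : P = ∅
  · rw [if_pos h] at hP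
    omega
  · rw [if_neg h] at hP
    have hne : P.Nonempty := Set.nonempty_iff_ne_empty.2 h
    refine ⟨hne, (AffineSubspace.direction_eq_top_iff_of_nonempty
      ((affineSpan_nonempty ℝ).2 hne)).1 (Submodule.eq_top_of_finrank_eq ?_)⟩
    rw [finrank_euclideanSpace_fin]
    exact_mod_cast hP

lemma eq_singleton_of_setDim_eq_zero {f : Set (EuclideanSpace ℝ (Fin D))}
    (hf : setDim f = 0) : ∃ v, f = {v} := by
  unfold setDim at hf
  split_ifs at hf with h
  · obtain ⟨v, hv⟩ := Set.nonempty_iff_ne_empty.2 h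
    refine ⟨v, Set.eq_singleton_iff_unique_mem.2 ⟨hv, fun x hx => ?_⟩⟩
    have hbot : (affineSpan ℝ f).direction = ⊥ := Submodule.finrank_eq_zero.1 (by exact_mod_cast hf)
    have := AffineSubspace.vsub_mem_direction (subset_affineSpan ℝ f hx) (subset_affineSpan ℝ f hv)
    rw [hbot, Submodule.mem_bot, vsub_eq_sub, sub_eq_zero] at this
    exact this

/-- By full dimension `x + t • a` stays in `P` for small `t > 0`, which equality at `x` would
forbid. -/
lemma inner_lt_of_mem_intrinsicInterior {P : Set (EuclideanSpace ℝ (Fin D))}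
    (hP : affineSpan ℝ P = ⊤) {a : EuclideanSpace ℝ (Fin D)} {b : ℝ} (ha : a ≠ 0)
    (hab : ∀ x ∈ P, ⟪a, x⟫ ≤ b) {x : EuclideanSpace ℝ (Fin D)}
    (hx : x ∈ intrinsicInterior ℝ P) : ⟪a, x⟫ < b := by
  obtain ⟨y, hy, rfl⟩ := mem_intrinsicInterior.1 hx
  have htop : ∀ z, z ∈ affineSpan ℝ P := fun z => hP ▸ AffineSubspace.mem_top ℝ _ z
  let f : ℝ → affineSpan ℝ P := fun t => ⟨y + t • a, htop _⟩
  have hf : Continuous f := by fun_prop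
  have hf0 : f 0 = y := Subtype.ext (by simp [f])
  have h1 : ∀ᶠ t in 𝓝[>] (0 : ℝ), (f t : EuclideanSpace ℝ (Fin D)) ∈ P := by
    have h2 : Tendsto f (𝓝[>] 0) (𝓝 y) := hf0 ▸ hf.continuousAt.mono_left nhdsWithin_le_nhds
    exact h2.eventually (mem_interior_iff_mem_nhds.1 hy)
  obtain ⟨t, ht, ht0⟩ := (h1.and self_mem_nhdsWithin).exists
  have h2 := hab _ ht
  have h3 : 0 < t * ⟪a, a⟫ := mul_pos ht0 (real_inner_self_pos.2 ha)
  simp only [f, inner_add_right, real_inner_smul_right] at h2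
  linarith

variable {a : Fin n → EuclideanSpace ℝ (Fin D)} {b : Fin n → ℝ}

lemma convex_polyhedron (a : Fin n → EuclideanSpace ℝ (Fin D)) (b : Fin n → ℝ) :
    Convex ℝ {x | ∀ i, ⟪a i, x⟫ ≤ b i} := by
  intro x hx y hy s t hs ht hst i
  have h1 := mul_le_mul_of_nonneg_left (hx i) hs
  have h2 := mul_le_mul_of_nonneg_left (hy i) ht
  have h3 : b i = s * b i + t * b i := by rw [← add_mul, hst, one_mul]
  simp only [inner_add_right, real_inner_smul_right]
  linarith

lemma exists_pos_add_smul_mem {v y : EuclideanSpace ℝ (Fin D)} (hv : ∀ i, ⟪a i, v⟫ ≤ b i)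
    (hy : ∀ i, ⟪a i, v⟫ = b i → ⟪a i, y⟫ ≤ 0) :
    ∃ ε : ℝ, 0 < ε ∧ ∀ i, ⟪a i, v + ε • y⟫ ≤ b i := by
  have h : ∀ᶠ ε in 𝓝[>] (0 : ℝ), ∀ i, ⟪a i, v + ε • y⟫ ≤ b i := by
    rw [eventually_all]
    intro i
    rcases (hv i).eq_or_lt with h | h
    · filter_upwards [self_mem_nhdsWithin] with ε hε
      rw [inner_add_right, real_inner_smul_right, h]
      linarith [mul_nonpos_of_nonneg_of_nonpos (le_of_lt hε) (hy i h)]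
    · have hc : Continuous fun ε : ℝ => ⟪a i, v + ε • y⟫ := by fun_prop
      have := (hc.continuousAt (x := 0)).eventually_lt (continuousAt_const (y := b i))
        (by simpa using h)
      exact (this.filter_mono nhdsWithin_le_nhds).mono fun _ => le_of_lt
  obtain ⟨ε, h1, h2⟩ := (h.and self_mem_nhdsWithin).exists
  exact ⟨ε, h2, h1⟩

/-- A direction orthogonal to all active normals can be followed both ways within `P`, and one way
stays in the halfspace that cuts out `v`. -/
lemma eq_zero_of_active_inner_eq_zero {v y : EuclideanSpace ℝ (Fin D)}
    (hv : IsFace {x | ∀ i, ⟪a i, x⟫ ≤ b i} {v})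
    (hy : ∀ i, ⟪a i, v⟫ = b i → ⟪a i, y⟫ = 0) : y = 0 := by
  obtain ⟨c, β, -, -, hf⟩ := hv
  have hvmem : v ∈ {x | ∀ i, ⟪a i, x⟫ ≤ b i} ∩ {x | ⟪c, x⟫ ≤ β} := hf ▸ Set.mem_singleton v
  have key : ∀ z, (∀ i, ⟪a i, v⟫ = b i → ⟪a i, z⟫ = 0) → ⟪c, z⟫ ≤ 0 → z = 0 := by
    intro z hz hcz
    obtain ⟨ε, hε, h⟩ := exists_pos_add_smul_mem hvmem.1 fun i hi => (hz i hi).le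
    have hmem : v + ε • z ∈ ({v} : Set (EuclideanSpace ℝ (Fin D))) := by
      rw [hf]
      refine ⟨h, ?_⟩
      have h1 : ⟪c, v⟫ ≤ β := hvmem.2
      have h2 := mul_nonpos_of_nonneg_of_nonpos hε.le hcz
      simp only [Set.mem_ofPred_eq, inner_add_right, real_inner_smul_right]
      linarith
    simpa [hε.ne'] using hmem
  rcases le_total ⟪c, y⟫ 0 with h | h
  · exact key y hy h
  · exact neg_eq_zero.1 (key (-y) (fun i hi => by simp [hy i hi]) (by simpa using h))

/-- The reversed sum of the inequalities in `I` is the cutting halfspace: equality in the sum forces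
equality in each term. For `I = ∅` the face is `P`, cut out by any defining halfspace, hence `0 <
n`. -/
lemma isFace_setOf_active (ha : ∀ i, a i ≠ 0) (hn : 0 < n)
    (hspan : affineSpan ℝ {x | ∀ i, ⟪a i, x⟫ ≤ b i} = ⊤) (I : Finset (Fin n))
    (hne : ∃ v, (∀ i, ⟪a i, v⟫ ≤ b i) ∧ ∀ i ∈ I, ⟪a i, v⟫ = b i) :
    IsFace {x | ∀ i, ⟪a i, x⟫ ≤ b i}
      {x | (∀ i, ⟪a i, x⟫ ≤ b i) ∧ ∀ i ∈ I, ⟪a i, x⟫ = b i} := by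
  have hlt : ∀ i, ∀ x ∈ intrinsicInterior ℝ {x | ∀ i, ⟪a i, x⟫ ≤ b i}, ⟪a i, x⟫ < b i :=
    fun i x hx => inner_lt_of_mem_intrinsicInterior hspan (ha i) (fun y hy => hy i) hx
  rcases I.eq_empty_or_nonempty with rfl | hI
  · refine ⟨a ⟨0, hn⟩, b ⟨0, hn⟩, ha _, ?_, ?_⟩
    · exact Set.disjoint_left.2 fun x hx hx' => (hlt _ x hx').ne hx
    · ext x
      simpa using fun h : ∀ i, ⟪a i, x⟫ ≤ b i => h ⟨0, hn⟩
  · obtain ⟨v, hv, hvI⟩ := hne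
    have hsum : ∀ x, ⟪-∑ i ∈ I, a i, x⟫ = -∑ i ∈ I, ⟪a i, x⟫ := fun x => by
      rw [inner_neg_left, sum_inner]
    have hint : ∀ x ∈ intrinsicInterior ℝ {x | ∀ i, ⟪a i, x⟫ ≤ b i},
        -∑ i ∈ I, b i < ⟪-∑ i ∈ I, a i, x⟫ := fun x hx => by
      rw [hsum]
      exact neg_lt_neg (Finset.sum_lt_sum_of_nonempty hI fun i _ => hlt i x hx)
    refine ⟨-∑ i ∈ I, a i, -∑ i ∈ I, b i, fun h0 => ?_, ?_, ?_⟩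
    · obtain ⟨q, hq⟩ := Set.Nonempty.intrinsicInterior (convex_polyhedron a b) ⟨v, hv⟩
      have h1 := hint q hq
      have h2 := hsum v
      rw [Finset.sum_congr rfl hvI, h0, inner_zero_left] at h2
      rw [h0, inner_zero_left, ← h2] at h1
      exact lt_irrefl _ h1
    · exact Set.disjoint_left.2 fun x hx hx' => (hint x hx').ne' hx
    · ext x
      simp only [Set.mem_inter_iff, Set.mem_ofPred_eq, hsum, neg_le_neg_iff]
      refine and_congr_right fun hx => ⟨fun h => (Finset.sum_congr rfl h).ge, fun h => ?_⟩
      exact (Finset.sum_eq_sum_iff_of_le fun i _ => hx i).1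
        (le_antisymm (Finset.sum_le_sum fun i _ => hx i) h)

lemma le_setDim_of_linearIndependent {k : ℕ} {F : Set (EuclideanSpace ℝ (Fin D))}
    {v : EuclideanSpace ℝ (Fin D)} (hv : v ∈ F) {w : Fin k → EuclideanSpace ℝ (Fin D)}
    (hw : LinearIndependent ℝ w) (hF : ∀ t, ∃ ε : ℝ, 0 < ε ∧ v + ε • w t ∈ F) :
    (k : ℤ) ≤ setDim F := by
  rw [setDim, if_neg (Set.nonempty_iff_ne_empty.1 ⟨v, hv⟩)]
  have h1 : Submodule.span ℝ (Set.range w) ≤ (affineSpan ℝ F).direction := by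
    rw [Submodule.span_le]
    rintro _ ⟨t, rfl⟩
    obtain ⟨ε, hε, hmem⟩ := hF t
    have := AffineSubspace.vsub_mem_direction (subset_affineSpan ℝ F hmem)
      (subset_affineSpan ℝ F hv)
    rw [vsub_eq_sub, add_sub_cancel_left] at this
    exact ((affineSpan ℝ F).direction.smul_mem_iff hε.ne').1 this
  have h2 := Submodule.finrank_mono h1
  rw [finrank_span_eq_card hw, Fintype.card_fin] at h2
  exact_mod_cast h2

lemma le_card_active {v : EuclideanSpace ℝ (Fin D)}
    (hker : ∀ y, (∀ i, ⟪a i, v⟫ = b i → ⟪a i, y⟫ = 0) → y = 0) :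
    D ≤ (Finset.univ.filter fun i => ⟪a i, v⟫ = b i).card := by
  have hinj : Function.Injective
      (LinearMap.pi fun i : Finset.univ.filter fun i => ⟪a i, v⟫ = b i => innerₗ _ (a i)) := by
    rw [← LinearMap.ker_eq_bot, LinearMap.ker_eq_bot']
    intro y hy
    refine hker y fun i hi => ?_
    have := congrFun hy ⟨i, by simpa using hi⟩
    simpa using this
  have := LinearMap.finrank_le_finrank_of_injective hinj
  rwa [finrank_euclideanSpace_fin, Module.finrank_fintype_fun_eq_card, Fintype.card_coe] at this

/-- If every face below the level `B` has dimension at most `d`, then each vertex below the level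
`B` minimizes `L` on a face that is cut out by exactly `d` facet hyperplanes. -/
lemma exists_active_card_eq {M : Type*} [AddCommGroup M] [LinearOrder M]
    [IsOrderedAddMonoid M] [Module ℝ M] [PosSMulStrictMono ℝ M]
    (ha : ∀ i, a i ≠ 0) (hspan : affineSpan ℝ {x | ∀ i, ⟪a i, x⟫ ≤ b i} = ⊤)
    {l : EuclideanSpace ℝ (Fin D) →ᵃ[ℝ] ℝ} {B : ℝ} {d : ℕ}
    (hd : ∀ f ∈ subLevelComplex {x | ∀ i, ⟪a i, x⟫ ≤ b i} l B, setDim f ≤ d) (hdD : d < D)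
    (L : EuclideanSpace ℝ (Fin D) →ₗ[ℝ] M) (hL : ∀ x, L x < 0 → l.linear x ≤ 0)
    {v : EuclideanSpace ℝ (Fin D)} (hv : ∀ i, ⟪a i, v⟫ ≤ b i) (hvB : l v < B)
    (hker : ∀ y, (∀ i, ⟪a i, v⟫ = b i → ⟪a i, y⟫ = 0) → y = 0) :
    ∃ J : Finset (Fin n), J.card = d ∧ (∀ i ∈ J, ⟪a i, v⟫ = b i) ∧
      ∀ x, (∀ i, ⟪a i, x⟫ ≤ b i) → (∀ i ∈ J, ⟪a i, x⟫ = b i) → L v ≤ L x := by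
  classical
  set A : Finset (Fin n) := Finset.univ.filter fun i => ⟪a i, v⟫ = b i with hA
  have hmemA : ∀ i, i ∈ A ↔ ⟪a i, v⟫ = b i := fun i => by simp [hA]
  let φ : Fin n → EuclideanSpace ℝ (Fin D) →ₗ[ℝ] ℝ := fun i => -(innerₗ _ (a i))
  have hφ : ∀ i x, φ i x = -⟪a i, x⟫ := fun i x => rfl
  have hcard : D ≤ A.card := le_card_active hker
  obtain ⟨I, hI, J, hJ, k, hJk, ⟨w, hw, hwI⟩, hneg, hnonneg⟩ :=
    exists_neg_face_and_nonneg_face φ A (fun y hy => hker y fun i hi => by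
      simpa [hφ] using hy i ((hmemA i).2 hi)) L
  have hn : 0 < n := by
    have := A.card_le_univ
    rw [Fintype.card_fin] at this
    omega
  have hvI : ∀ i ∈ I, ⟪a i, v⟫ = b i := fun i hi => (hmemA i).1 (hI hi)
  have hkd : k ≤ d := by
    have h1 : (k : ℤ) ≤ setDim {x | (∀ i, ⟪a i, x⟫ ≤ b i) ∧ ∀ i ∈ I, ⟪a i, x⟫ = b i} := by
      refine le_setDim_of_linearIndependent (v := v) ⟨hv, hvI⟩ hw fun t => ?_
      obtain ⟨ε, hε, h⟩ := exists_pos_add_smul_mem hv (y := w t) fun i hi => by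
        simpa [hφ] using (hwI t).1 i ((hmemA i).2 hi)
      refine ⟨ε, hε, h, fun i hi => ?_⟩
      have h0 : ⟪a i, w t⟫ = 0 := by simpa [hφ] using (hwI t).2 i hi
      rw [inner_add_right, real_inner_smul_right, h0, hvI i hi, mul_zero, add_zero]
    -- For `p ≠ v` on this face, `p - v` lies in the negative face, so `l p ≤ l v < B`.
    have h2 := hd _ ⟨isFace_setOf_active ha hn hspan I ⟨v, hv, hvI⟩, fun p hp => ?_⟩
    · exact_mod_cast h1.trans h2
    · by_cases hpv : p = v
      · rwa [hpv]
      · have h3 := hL _ (hneg (p - v) ⟨fun i hi => ?_, fun i hi => ?_⟩ (sub_ne_zero.2 hpv))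
        · have h4 : l.linear (p - v) = l p - l v := l.linearMap_vsub p v
          linarith
        · have := hp.1 i
          rw [hφ, inner_sub_right, (hmemA i).1 hi]
          linarith
        · rw [hφ, inner_sub_right, hvI i hi, hp.2 i hi]
          simp
  obtain ⟨J', hJJ', hJ'A, hJ'⟩ := Finset.exists_subsuperset_card_eq hJ (hJk.trans hkd)
    (hdD.le.trans hcard)
  refine ⟨J', hJ', fun i hi => (hmemA i).1 (hJ'A hi), fun x hx hxJ => ?_⟩
  have := hnonneg (x - v) ⟨fun i hi => ?_, fun i hi => ?_⟩
  · rwa [map_sub, sub_nonneg] at this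
  · have := hx i
    rw [hφ, inner_sub_right, (hmemA i).1 hi]
    linarith
  · rw [hφ, inner_sub_right, (hmemA i).1 (hJ hi), hxJ i (hJJ' hi)]
    simp

end Polyhedron

/-! ### Lexicographic perturbation and the final count. -/

lemma posSMulStrictMono_real_lex : PosSMulStrictMono ℝ (ℝ ×ₗ ℝ) where
  smul_lt_smul_of_pos_left c hc x y hxy := by
    rw [Prod.Lex.lt_iff] at hxy ⊢
    rcases hxy with h | ⟨h1, h2⟩
    · exact Or.inl (mul_lt_mul_of_pos_left h hc)
    · exact Or.inr ⟨congrArg (c * ·) h1, mul_lt_mul_of_pos_left h2 hc⟩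

/-- A set with an assignment of `d`-subsets of `Fin n` that is minimized by its points has at most
`C(n, d) - C(D, d) + 1` elements. -/
lemma card_add_choose_le {E M : Type*} [LinearOrder M] {n D d : ℕ} (X : Finset E) (L : E → M)
    (hL : Set.InjOn L X) (T : E → Finset (Fin n)) (J : E → Finset (Fin n))
    (hJ : ∀ v ∈ X, (J v).card = d) (hJT : ∀ v ∈ X, J v ⊆ T v) (hT : ∀ v ∈ X, D ≤ (T v).card)
    (hmin : ∀ v ∈ X, ∀ x ∈ X, J v ⊆ T x → L v ≤ L x) (hne : X.Nonempty) :
    X.card + D.choose d ≤ n.choose d + 1 := by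
  classical
  obtain ⟨v₀, hv₀, hv₀min⟩ := X.exists_min_image L hne
  have hinj : Set.InjOn J (X.erase v₀ : Finset E) := by
    intro v hv x hx h
    have hv := Finset.mem_of_mem_erase (Finset.mem_coe.1 hv)
    have hx := Finset.mem_of_mem_erase (Finset.mem_coe.1 hx)
    exact hL hv hx (le_antisymm (hmin v hv x hx (h ▸ hJT x hx)) (hmin x hx v hv (h ▸ hJT v hv)))
  -- If `J v` is tight at `v₀`, then `L v ≤ L v₀`, so `v = v₀`.
  have hdisj : Disjoint ((X.erase v₀).image J) ((T v₀).powersetCard d) := by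
    rw [Finset.disjoint_left]
    intro S hS hS'
    obtain ⟨v, hv, rfl⟩ := Finset.mem_image.1 hS
    obtain ⟨hne, hv⟩ := Finset.mem_erase.1 hv
    exact hne (hL hv hv₀ (le_antisymm (hmin v hv v₀ hv₀ (Finset.mem_powersetCard.1 hS').1)
      (hv₀min v hv)))
  have hsub : (X.erase v₀).image J ∪ (T v₀).powersetCard d ⊆
      (Finset.univ : Finset (Fin n)).powersetCard d := by
    intro S hS
    rw [Finset.mem_powersetCard]
    refine ⟨Finset.subset_univ _, ?_⟩
    rcases Finset.mem_union.1 hS with hS | hS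
    · obtain ⟨v, hv, rfl⟩ := Finset.mem_image.1 hS
      exact hJ v (Finset.mem_of_mem_erase hv)
    · exact (Finset.mem_powersetCard.1 hS).2
  have hle := Finset.card_le_card hsub
  rw [Finset.card_union_of_disjoint hdisj, Finset.card_image_of_injOn hinj,
    Finset.card_powersetCard, Finset.card_powersetCard, Finset.card_univ, Fintype.card_fin,
    Finset.card_erase_of_mem hv₀] at hle
  have := Nat.choose_le_choose d (hT v₀ hv₀)
  have := hne.card_pos
  omega

theorem theorem1 (D n d : ℕ)
    (H : Fin n → Set (EuclideanSpace ℝ (Fin D))) (hH : ∀ i, IsClosedHalfspace (H i))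
    (P : Set (EuclideanSpace ℝ (Fin D))) (hP : P = ⋂ i, H i)
    (hfull : setDim P = (D : ℤ))
    (hpointed : (vertexFaces P).Nonempty)
    (l : EuclideanSpace ℝ (Fin D) →ᵃ[ℝ] ℝ) (m : ℝ) (hm : IsLeast (l '' P) m)
    (B : ℝ) (hB : m < B)
    (hd : HasComplexDim (subLevelComplex P l B) (d : ℤ)) (hdD : d < D) :
    {f | f ∈ subLevelComplex P l B ∧ setDim f = 0}.Finite ∧
      ({f | f ∈ subLevelComplex P l B ∧ setDim f = 0}.ncard : ℤ) ≤
        (n.choose d : ℤ) - (D.choose d : ℤ) + 1 := by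
  classical
  choose a b ha hab using hH
  obtain rfl : P = {x | ∀ i, ⟪a i, x⟫ ≤ b i} := by
    rw [hP]
    ext x
    simp [hab]
  have hspan := (affineSpan_eq_top_of_setDim_eq hfull).2
  set P : Set (EuclideanSpace ℝ (Fin D)) := {x | ∀ i, ⟪a i, x⟫ ≤ b i} with hPdef
  set X : Set (EuclideanSpace ℝ (Fin D)) := {v | {v} ∈ subLevelComplex P l B} with hX
  have hset : {f | f ∈ subLevelComplex P l B ∧ setDim f = 0} = (fun v => {v}) '' X := by
    ext f
    constructor
    · rintro ⟨hf, h0⟩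
      obtain ⟨v, rfl⟩ := eq_singleton_of_setDim_eq_zero h0
      exact ⟨v, hf, rfl⟩
    · rintro ⟨v, hv, rfl⟩
      refine ⟨hv, ?_⟩
      rw [setDim, if_neg (Set.singleton_ne_empty v), direction_affineSpan, vectorSpan_singleton,
        finrank_bot, Nat.cast_zero]
  have hmemP : ∀ v, IsFace P {v} → ∀ i, ⟪a i, v⟫ ≤ b i := by
    rintro v ⟨c, β, -, -, hf⟩
    have : v ∈ P ∩ {x | ⟪c, x⟫ ≤ β} := hf ▸ Set.mem_singleton v
    exact this.1
  have hker : ∀ v, IsFace P {v} → ∀ y, (∀ i, ⟪a i, v⟫ = b i → ⟪a i, y⟫ = 0) → y = 0 :=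
    fun v hv y => eq_zero_of_active_inner_eq_zero hv
  let T : EuclideanSpace ℝ (Fin D) → Finset (Fin n) := fun v =>
    Finset.univ.filter fun i => ⟪a i, v⟫ = b i
  have hmemT : ∀ v i, i ∈ T v ↔ ⟪a i, v⟫ = b i := fun v i => by simp [T]
  have hXfin : X.Finite := by
    refine Set.Finite.of_injOn (f := T) (t := Set.univ) (fun _ _ => Set.mem_univ _) ?_
      Set.finite_univ
    intro v hv x hx hvx
    refine (sub_eq_zero.1 (hker v hv.1 (x - v) fun i hi => ?_)).symm
    have hi' := (hmemT x i).1 (hvx ▸ (hmemT v i).2 hi)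
    rw [inner_sub_right, hi, hi', sub_self]
  have : Finite X := hXfin
  -- `g` separates the finitely many points of `X`; as second lexicographic coordinate it breaks the
  -- ties of `ℓ`.
  obtain ⟨g, hg⟩ := Module.exists_dual_forall_apply_ne_zero (K := ℝ)
    (fun p : {p : X × X // p.1 ≠ p.2} => (p.1.1 : EuclideanSpace ℝ (Fin D)) - p.1.2)
    fun p => sub_ne_zero.2 fun h => p.2 (Subtype.ext h)
  have := posSMulStrictMono_real_lex
  let L : EuclideanSpace ℝ (Fin D) →ₗ[ℝ] ℝ ×ₗ ℝ :=
    (toLexLinearEquiv ℝ (ℝ × ℝ)).toLinearMap ∘ₗ l.linear.prod g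
  have hLX : Set.InjOn L X := by
    intro v hv x hx h
    by_contra hne
    refine hg ⟨(⟨v, hv⟩, ⟨x, hx⟩), fun h => hne (congrArg Subtype.val h)⟩ ?_
    have : g v = g x := congrArg (fun z : ℝ ×ₗ ℝ => (ofLex z).2) h
    simp [this]
  have hL : ∀ x, L x < 0 → l.linear x ≤ 0 := fun x hx => by
    rcases Prod.Lex.lt_iff.1 hx with h | h
    · exact le_of_lt h
    · exact le_of_eq h.1
  have hfaces : ∀ f ∈ subLevelComplex P l B, setDim f ≤ d := fun f hf => hd.2 ⟨f, hf, rfl⟩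
  have hcard : ∀ v, IsFace P {v} → D ≤ (T v).card := fun v hv => le_card_active (hker v hv)
  refine ⟨hset ▸ hXfin.image _, ?_⟩
  rw [hset, Set.ncard_image_of_injective _ Set.singleton_injective]
  have hvert : ∀ v ∈ X, ∃ J : Finset (Fin n), J.card = d ∧ (∀ i ∈ J, ⟪a i, v⟫ = b i) ∧
      ∀ x, (∀ i, ⟪a i, x⟫ ≤ b i) → (∀ i ∈ J, ⟪a i, x⟫ = b i) → L v ≤ L x := fun v hv =>
    exists_active_card_eq ha hspan hfaces hdD L hL (hmemP v hv.1) (hv.2 v rfl) (hker v hv.1)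
  choose! J hJ hJT hJmin using hvert
  rcases X.eq_empty_or_nonempty with h0 | hne
  -- Here `D ≤ n` suffices, and any vertex of `P` supplies it.
  · obtain ⟨f, hf, hf0⟩ := hpointed
    obtain ⟨v, rfl⟩ := eq_singleton_of_setDim_eq_zero hf0
    have h1 := (hcard v hf).trans (Finset.card_le_univ _)
    rw [Fintype.card_fin] at h1
    have := Nat.choose_le_choose d h1
    rw [h0, Set.ncard_empty]
    omega
  · have := card_add_choose_le (D := D) hXfin.toFinset L (by simpa using hLX) T J
      (fun v hv => hJ v (by simpa using hv))
      (fun v hv i hi => (hmemT v i).2 (hJT v (by simpa using hv) i hi))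
      (fun v hv => hcard v ((hXfin.mem_toFinset.1 hv).1))
      (fun v hv x hx h => hJmin v (by simpa using hv) x (hmemP x (hXfin.mem_toFinset.1 hx).1)
        fun i hi => (hmemT x i).1 (h hi)) (by simpa using hne)
    rw [Set.ncard_eq_toFinset_card X hXfin]
    omega
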